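/- Let $d\ge 1$ and let $\mathcal U$ be a $d$-dimensional update family, i.e. a finite collection of finite subsets of $\mathbb Z^d\setminus\{0\}$. For $A\subset\mathbb Z^d$ put $A_0=A$, $A_{t}=A_{t-1}\cup\{x\in\mathbb Z^d: x+X\subset A_{t-1}\text{ for some }X\in\mathcal U\}$ for $t\ge1$, and $[A]_{\mathcal U}=\bigcup_{t\ge0}A_t$. For $u$ in the Euclidean unit sphere $\mathbf S^{d-1}\subset\mathbb R^d$ let $\mathbb H_u^d=\{x\in\mathbb Z^d:\langle x,u\rangle<0\}$, and let $\mathcal S=\{u\in\mathbf S^{d-1}:[\mathbb H_u^d]_{\mathcal U}=\mathbb H_u^d\}$ be the set of stable directions. Suppose that $\mathcal U$ is subcritical, meaning that for every open hemisphere $H=\{v\in\mathbf S^{d-1}:\langle w,v\rangle>0\}$, $w\in\mathbf S^{d-1}$, the interior of $H\cap\mathcal S$ in $\mathbf S^{d-1}$ is non-empty. For $p\in[0,1]$ let $\mathbb P_p$ be the law of a random set $A\subset\mathbb Z^d$ that contains each site independently with probability $p$. Then $$\mathbb P_p\big(0\in[A]_{\mathcal U}\big)=O\big(p^{2/3}\big),$$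 that is, there is a constant $C>0$, depending only on $d$ and $\mathcal U$, such that $\mathbb P_p(0\in[A]_{\mathcal U})\le C\,p^{2/3}$ for all $p\in[0,1]$. In particular, the critical probability $$p_c(\mathbb Z^d,\mathcal U)=\inf\big\{p\in[0,1]:\mathbb P_p\big([A]_{\mathcal U}=\mathbb Z^d\big)\ge 1/2\big\}$$ is strictly positive. -/

import Mathlib

namespace UBootstrap

/-- A `d`-dimensional update family: a finite collection of finite subsets of `ℤ^d ∖ {0}`. -/
structure UpdateFamily (d : ℕ) where
  /-- The update rules. -/
  rules : Finset (Finset (Fin d → ℤ))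
  zero_notMem : ∀ X ∈ rules, (0 : Fin d → ℤ) ∉ X

variable {d : ℕ}

/-- One step of the dynamics: `B ∪ {x : x + X ⊆ B for some X ∈ U}`. -/
def step (U : UpdateFamily d) (B : Set (Fin d → ℤ)) : Set (Fin d → ℤ) :=
  B ∪ {x | ∃ X ∈ U.rules, ∀ y ∈ X, x + y ∈ B}

/-- The set `A_t` of sites infected at time `t`, when started from `A_0 = A`. -/
def infectedAt (U : UpdateFamily d) (A : Set (Fin d → ℤ)) : ℕ → Set (Fin d → ℤ)
  | 0 => A
  | t + 1 => step U (infectedAt U A t)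

/-- The `U`-closure `[A]_U`, the set of all eventually infected sites. -/
def uClosure (U : UpdateFamily d) (A : Set (Fin d → ℤ)) : Set (Fin d → ℤ) :=
  ⋃ t : ℕ, infectedAt U A t

/-- The unit sphere `S^{d-1}` of Euclidean space `ℝ^d` (with the subspace topology). -/
abbrev UnitSphere (d : ℕ) : Type :=
  Metric.sphere (0 : EuclideanSpace ℝ (Fin d)) 1

/-- The inclusion `ℤ^d ⊆ ℝ^d`. -/
def toEuclid (x : Fin d → ℤ) : EuclideanSpace ℝ (Fin d) :=
  WithLp.toLp 2 (fun i => (x i : ℝ))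

/-- The discrete half-space `{x ∈ ℤ^d : ⟨x, u⟩ < 0}`. -/
def halfSpace (u : UnitSphere d) : Set (Fin d → ℤ) :=
  {x | inner ℝ (toEuclid x) (u : EuclideanSpace ℝ (Fin d)) < 0}

/-- The set of stable directions of `U`. -/
def stableSet (U : UpdateFamily d) : Set (UnitSphere d) :=
  {u | uClosure U (halfSpace u) = halfSpace u}

/-- The open hemisphere centred at `w`. (For `d ≥ 1` the closed hemisphere has the same interior,
so that using closed hemispheres in `IsSubcritical` would give the same notion.) -/
def hemisphere (w : UnitSphere d) : Set (UnitSphere d) :=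
  {v | 0 < inner ℝ (w : EuclideanSpace ℝ (Fin d)) (v : EuclideanSpace ℝ (Fin d))}

/-- `U` is subcritical if `int (H ∩ S)` is nonempty for every hemisphere `H`, where the interior
is taken in the sphere. -/
def IsSubcritical (U : UpdateFamily d) : Prop :=
  ∀ w : UnitSphere d, (interior (hemisphere w ∩ stableSet U)).Nonempty

/-- The law `ℙ_p` of a `p`-random subset of `ℤ^d`: each site is included independently with
probability `p`. -/
noncomputable def siteLaw (d : ℕ) (p : unitInterval) : MeasureTheory.Measure (Set (Fin d → ℤ)) :=
  ProbabilityTheory.setBernoulli (Set.univ : Set (Fin d → ℤ)) p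

/-- The critical probability `inf {p ∈ [0,1] : ℙ_p ([A]_U = ℤ^d) ≥ 1/2}`. -/
noncomputable def criticalProb (U : UpdateFamily d) : ℝ :=
  sInf {p : ℝ | ∃ hp : p ∈ unitInterval,
    1 / 2 ≤ (siteLaw d ⟨p, hp⟩).real {A | uClosure U A = Set.univ}}

end UBootstrap

/-! Subcriticality yields finitely many directions `u`, with some `⟨x, u⟩ ≥ c₀ ‖x‖` for each `x`,
along all of which every rule has a site at height at least `δ > 0`
(`IsSubcritical.exists_directions`). Hence a droplet whose walls `L i x ≤ F i x` have small slope
cannot grow by itself.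

To handle other droplets near a wall, a finite initial set is sorted into isolated clusters of
scales `r n ≪ R n`, each surrounded by a droplet. The walls of a large droplet are bulged so that
each smaller cluster lies deep inside or well clear of them (`exists_lipschitz_majorant`). The union
of droplets is then closed under the dynamics (`exists_closed_superset`), so infection of the origin
forces a point of some `n`-th sparse set nearby.

Such a point needs `2 ^ n` initial sites from one of at most `Λ ^ 2 ^ n` sets, which costs `(Λ p) ^
2 ^ n`. Summing over `n` gives `O(p)`, stronger than `O(p^(2/3))`, and positivity of the critical
probability follows. -/

namespace UBootstrap

/-! ### Raising Lipschitz walls around isolated obstacles -/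

section Majorant

variable {V : Type*} [NormedAddCommGroup V]

/-- Cones of slope `e` are put on the obstacles near or below the graph of `F₀`. They fall faster
than `F₀` can, so they are below it at distance `R` and clusters do not interact. -/
theorem exists_lipschitz_majorant_step (L : V →+ ℝ) {C e₀ e e' τ r R : ℝ} {E : Set V} {F₀ : V → ℝ}
    (hC : ∀ v, |L v| ≤ C * ‖v‖) (he' : 0 ≤ e') (he : e' ≤ e) (he₀ : e ≤ e₀)
    (hτ : 0 ≤ τ) (hr : 0 ≤ r) (hC0 : 0 ≤ C)
    (hsep : ∀ z ∈ E, ∀ z' ∈ E, ‖z - z'‖ ≤ R → ‖z - z'‖ ≤ r)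
    (hhill : (2 * τ + 1 + C + e₀) * r ≤ (e - e') * R)
    (hF₀ : ∀ x y, F₀ x ≤ F₀ y + e' * ‖x - y‖) :
    ∃ F : V → ℝ, (∀ x y, F x ≤ F y + e * ‖x - y‖) ∧ (∀ x, F₀ x ≤ F x) ∧
      (∀ x, F x ≤ F₀ x + (2 * τ + 1 + C + e₀) * r) ∧
      ∀ z ∈ E, L z ≤ F z + (τ + 1) * r → L z + τ * r ≤ F z := by
  -- `H` is the margin `τ * r` plus the possible loss `(C + e₀) * r` across a cluster. The extra `r`
  -- in `T` leaves room for later raising at lower levels.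
  set H : ℝ := (τ + C + e₀) * r with hH
  set T : ℝ := (τ + 1) * r with hT
  let S : V → Set ℝ := fun x => {t | t = F₀ x ∨
    ∃ z ∈ E, L z ≤ F₀ z + T ∧ t = L z + H - e * ‖x - z‖}
  have hill : ∀ x z, L z ≤ F₀ z + T →
      L z + H - e * ‖x - z‖ ≤ F₀ x + (2 * τ + 1 + C + e₀) * r - (e - e') * ‖x - z‖ := by
    intro x z h
    have := hF₀ z x
    rw [norm_sub_rev] at this
    rw [hH]; rw [hT] at h
    linarith
  have hub : ∀ x, ∀ t ∈ S x, t ≤ F₀ x + (2 * τ + 1 + C + e₀) * r := by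
    rintro x t (rfl | ⟨z, -, hz, rfl⟩)
    · have : 0 ≤ (2 * τ + 1 + C + e₀) * r := by
        apply mul_nonneg _ hr; linarith
      linarith
    · have := hill x z hz
      have : 0 ≤ (e - e') * ‖x - z‖ := mul_nonneg (by linarith) (norm_nonneg _)
      linarith
  have hbdd : ∀ x, BddAbove (S x) := fun x => ⟨_, fun t ht => hub x t ht⟩
  have hmem : ∀ x, F₀ x ∈ S x := fun x => Or.inl rfl
  refine ⟨fun x => sSup (S x), ?_, fun x => le_csSup (hbdd x) (hmem x),
    fun x => csSup_le ⟨_, hmem x⟩ (hub x), ?_⟩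
  · intro x y
    refine csSup_le ⟨_, hmem x⟩ ?_
    rintro t (rfl | ⟨z, hzE, hz, rfl⟩)
    · have h1 := le_csSup (hbdd y) (hmem y)
      have h2 := hF₀ x y
      have h3 : e' * ‖x - y‖ ≤ e * ‖x - y‖ := mul_le_mul_of_nonneg_right he (norm_nonneg _)
      linarith
    · have h1 := le_csSup (hbdd y) (Or.inr ⟨z, hzE, hz, rfl⟩)
      have h2 : ‖y - z‖ ≤ ‖x - z‖ + ‖x - y‖ := by
        have := norm_sub_le_norm_sub_add_norm_sub y x z
        rw [norm_sub_rev y x] at this; linarith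
      have h3 := mul_le_mul_of_nonneg_left h2 (he'.trans he)
      linarith
  · intro z hzE hz
    have key : L z ≤ F₀ z + T → L z + τ * r ≤ sSup (S z) := by
      intro h
      have h1 := le_csSup (hbdd z) (Or.inr ⟨z, hzE, h, rfl⟩)
      simp only [sub_self, norm_zero, mul_zero, sub_zero] at h1
      have : 0 ≤ (C + e₀) * r := mul_nonneg (by linarith) hr
      linarith
    by_cases hnear : ∃ z' ∈ E, L z' ≤ F₀ z' + T ∧ ‖z - z'‖ ≤ R
    · obtain ⟨z', hz'E, hz', hd⟩ := hnear
      have hd' := hsep z hzE z' hz'E hd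
      have h1 := le_csSup (hbdd z) (Or.inr ⟨z', hz'E, hz', rfl⟩)
      have h2 : L z - L z' ≤ C * r := by
        rw [← map_sub]
        exact (le_abs_self _).trans ((hC _).trans (mul_le_mul_of_nonneg_left hd' hC0))
      have h3 : e * ‖z - z'‖ ≤ e₀ * r :=
        mul_le_mul he₀ hd' (norm_nonneg _) (by linarith)
      linarith
    -- Every cone has sunk below `F₀` at `z`, so `z` is close enough to `F₀` to carry a cone itself.
    · push Not at hnear
      apply key
      have : sSup (S z) ≤ F₀ z := by
        refine csSup_le ⟨_, hmem z⟩ ?_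
        rintro t (rfl | ⟨z', hz'E, hz', rfl⟩)
        · exact le_rfl
        · have h1 := hill z z' hz'
          have h2 := mul_le_mul_of_nonneg_left (hnear z' hz'E hz').le (sub_nonneg.2 he)
          linarith
      linarith

/-- A Lipschitz function can be raised slightly so that its subgraph swallows every obstacle of
the levels below `k` which it comes close to. -/
theorem exists_lipschitz_majorant (L : V →+ ℝ) {C τ : ℝ} {r R e : ℕ → ℝ} {E : ℕ → Set V}
    (hC : ∀ v, |L v| ≤ C * ‖v‖) (hC0 : 0 ≤ C) (hτ : 0 ≤ τ) (hr : ∀ m, 0 ≤ r m)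
    (he0 : ∀ m, 0 ≤ e m) (he : Antitone e)
    (hsep : ∀ m, ∀ z ∈ E m, ∀ z' ∈ E m, ‖z - z'‖ ≤ R m → ‖z - z'‖ ≤ r m)
    (hhill : ∀ m, (2 * τ + 1 + C + e 0) * r m ≤ (e m - e (m + 1)) * R m)
    (hgrow : ∀ m, (2 * τ + 2 + C + e 0) * r m ≤ r (m + 1)) (k : ℕ) :
    ∀ F₀ : V → ℝ, (∀ x y, F₀ x ≤ F₀ y + e k * ‖x - y‖) →
    ∃ F : V → ℝ, (∀ x y, F x ≤ F y + e 0 * ‖x - y‖) ∧ (∀ x, F₀ x ≤ F x) ∧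
      (∀ x, F x ≤ F₀ x + r k) ∧
      ∀ m < k, ∀ z ∈ E m, L z ≤ F z + τ * r m → L z + τ * r m ≤ F z := by
  induction k with
  | zero =>
    intro F₀ hF₀
    exact ⟨F₀, hF₀, fun _ => le_rfl, fun x => by linarith [hr 0], by simp⟩
  | succ k ih =>
    intro F₀ hF₀
    -- Levels are treated from the largest down, spending slope `e k - e (k + 1)`. The lower levels
    -- then raise the wall by at most `r k`.
    obtain ⟨F₁, h1, h2, h3, h4⟩ := exists_lipschitz_majorant_step L hC (he0 (k + 1))
      (he (Nat.le_succ k)) (he (Nat.zero_le k)) hτ (hr k) hC0 (hsep k) (hhill k) hF₀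
    obtain ⟨F, g1, g2, g3, g4⟩ := ih F₁ h1
    refine ⟨F, g1, fun x => (h2 x).trans (g2 x), fun x => ?_, fun m hm z hz hLz => ?_⟩
    · have := g3 x
      have := h3 x
      have := hgrow k
      linarith
    · rcases Nat.lt_succ_iff_lt_or_eq.1 hm with hm | rfl
      · exact g4 m hm z hz hLz
      · refine (h4 z hz ?_).trans (g2 z)
        have := g3 z
        linarith

end Majorant

/-! ### Hierarchy of isolated clusters -/

section Sparse

variable {V : Type*} [NormedAddCommGroup V]

/-- The points of `A` surviving the successive removal of isolated clusters: the `n`-th step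
removes the points whose `R n`-neighbourhood is contained in their `r n`-neighbourhood. -/
def sparse (r R : ℕ → ℝ) (A : Set V) : ℕ → Set V
  | 0 => A
  | n + 1 => {x | x ∈ sparse r R A n ∧
      ∃ y ∈ sparse r R A n, r n < ‖x - y‖ ∧ ‖x - y‖ ≤ R n}

theorem sparse_succ_subset (r R : ℕ → ℝ) (A : Set V) (n : ℕ) :
    sparse r R A (n + 1) ⊆ sparse r R A n := fun _ h => h.1

theorem sparse_subset (r R : ℕ → ℝ) (A : Set V) (n : ℕ) : sparse r R A n ⊆ A := by
  induction n with
  | zero => exact subset_rfl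
  | succ n ih => exact (sparse_succ_subset r R A n).trans ih

theorem norm_sub_le_of_mem_sparse_diff {r R : ℕ → ℝ} {A : Set V} {n : ℕ} {z y : V}
    (hz : z ∈ sparse r R A n \ sparse r R A (n + 1)) (hy : y ∈ sparse r R A n)
    (h : ‖z - y‖ ≤ R n) : ‖z - y‖ ≤ r n := by
  by_contra hlt
  exact hz.2 ⟨hz.1, y, hy, not_le.1 hlt, h⟩

theorem sparse_eventually_empty {r R : ℕ → ℝ} (hr : Filter.Tendsto r Filter.atTop Filter.atTop)
    {A : Set V} (hA : A.Finite) : ∃ N, ∀ n, N ≤ n → sparse r R A n = ∅ := by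
  obtain ⟨D, hD⟩ := (hA.isBounded).exists_norm_le
  obtain ⟨N, hN⟩ := Filter.eventually_atTop.1 (hr.eventually_ge_atTop (D + D))
  refine ⟨N + 1, fun n hn => ?_⟩
  obtain ⟨m, rfl⟩ : ∃ m, n = m + 1 := ⟨n - 1, by omega⟩
  refine Set.eq_empty_of_forall_notMem ?_
  rintro x ⟨hx, y, hy, h, -⟩
  have := hN m (by omega)
  have h1 := hD x (sparse_subset _ _ _ _ hx)
  have h2 := hD y (sparse_subset _ _ _ _ hy)
  have := norm_sub_le x y
  linarith

theorem exists_mem_sparse_diff {r R : ℕ → ℝ} (hr : Filter.Tendsto r Filter.atTop Filter.atTop)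
    {A : Set V} (hA : A.Finite) {x : V} (hx : x ∈ A) :
    ∃ n, x ∈ sparse r R A n \ sparse r R A (n + 1) := by
  by_contra! h
  obtain ⟨N, hN⟩ := sparse_eventually_empty (R := R) hr hA
  have : ∀ n, x ∈ sparse r R A n := by
    intro n
    induction n with
    | zero => exact hx
    | succ n ih =>
      by_contra hn
      exact h n ⟨ih, hn⟩
  have h1 := this N
  rw [hN N le_rfl] at h1
  exact h1

end Sparse

/-- The scales: distances and heights attached to the obstacles of each level. -/
structure Scales (C c₀ Rg ε τ D : ℝ) (r R e : ℕ → ℝ) : Prop where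
  C_nonneg : 0 ≤ C
  c₀_pos : 0 < c₀
  Rg_nonneg : 0 ≤ Rg
  one_le_r : ∀ n, 1 ≤ r n
  tendsto_r : Filter.Tendsto r Filter.atTop Filter.atTop
  e_nonneg : ∀ n, 0 ≤ e n
  e_anti : Antitone e
  e_zero : e 0 = ε
  D_eq : c₀ * D = C + 1
  τ_eq : τ = (C + ε) * (D + 2 * Rg)
  hill : ∀ m, (2 * τ + 1 + C + ε) * r m ≤ (e m - e (m + 1)) * R m
  grow : ∀ m, (2 * τ + 2 + C + ε) * r m ≤ r (m + 1)
  two_r_le : ∀ m, 2 * r m ≤ R m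
  sep : ∀ m, 2 * D * r m + 2 * Rg ≤ R m

/-! ### Closed unions of droplets -/

section ClosedSets

variable {V ι : Type*} [NormedAddCommGroup V]

theorem exists_closed_superset {L : ι → V →+ ℝ} {C c₀ Rg ε δ τ D : ℝ} {r R e : ℕ → ℝ}
    (hs : Scales C c₀ Rg ε τ D r R e)
    (hC : ∀ i v, |L i v| ≤ C * ‖v‖)
    (hc : ∀ v t, 0 ≤ t → (∀ i, L i v ≤ t) → c₀ * ‖v‖ ≤ t)
    (hε : ε * Rg ≤ δ) {A : Set V} (hA : A.Finite) :
    ∃ W : Set V, A ⊆ W ∧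
      (∀ X : Finset V, X.Nonempty → (∀ y ∈ X, ‖y‖ ≤ Rg) → (∀ i, ∃ y ∈ X, δ ≤ L i y) →
        ∀ x, (∀ y ∈ X, x + y ∈ W) → x ∈ W) ∧
      ∀ x ∈ W, ∃ n, ∃ z ∈ sparse r R A n, ‖x - z‖ ≤ D * r n := by
  have hr0 : ∀ n, 0 ≤ r n := fun n => zero_le_one.trans (hs.one_le_r n)
  have hε0 : 0 ≤ ε := hs.e_zero ▸ hs.e_nonneg 0
  have hD0 : 0 ≤ D := by
    have h1 := hs.C_nonneg
    have h2 := hs.D_eq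
    have h3 := hs.c₀_pos
    by_contra! h
    have := mul_neg_of_pos_of_neg h3 h
    linarith
  have hτ0 : 0 ≤ τ := by
    rw [hs.τ_eq]
    have := hs.C_nonneg
    have := hs.Rg_nonneg
    positivity
  let E : ℕ → Set V := fun n => sparse r R A n \ sparse r R A (n + 1)
  have hsep : ∀ m, ∀ z ∈ E m, ∀ z' ∈ E m, ‖z - z'‖ ≤ R m → ‖z - z'‖ ≤ r m :=
    fun m z hz z' hz' h => norm_sub_le_of_mem_sparse_diff hz hz'.1 h
  have hmaj : ∀ (i : ι) (k : ℕ) (a : ℝ), ∃ F : V → ℝ,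
      (∀ x y, F x ≤ F y + ε * ‖x - y‖) ∧ (∀ x, a ≤ F x) ∧ (∀ x, F x ≤ a + r k) ∧
      ∀ m < k, ∀ z ∈ E m, L i z ≤ F z + τ * r m → L i z + τ * r m ≤ F z := by
    intro i k a
    have := exists_lipschitz_majorant (L i) (hC i) hs.C_nonneg hτ0 hr0 hs.e_nonneg hs.e_anti hsep
      (by rw [hs.e_zero]; exact hs.hill) (by rw [hs.e_zero]; exact hs.grow) k (fun _ => a)
      (fun x y => by have := mul_nonneg (hs.e_nonneg k) (norm_nonneg (x - y)); linarith)
    rwa [hs.e_zero] at this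
  choose F hFlip hFge hFle hFcl using hmaj
  let K : ℕ → V → Set V := fun n z => {y | y ∈ sparse r R A n ∧ ‖z - y‖ ≤ R n}
  -- The height depends only on the cluster `K n z`, so all points of one cluster share the same
  -- walls.
  let a : ℕ → V → ι → ℝ := fun n z i => sSup (L i '' K n z)
  have hKfin : ∀ n z i, (L i '' K n z).Finite := fun n z i =>
    (hA.subset fun y hy => sparse_subset r R A n hy.1).image _
  have hRr : ∀ n, r n ≤ R n := fun n => by linarith [hs.two_r_le n, hr0 n]
  have hzK : ∀ n z, z ∈ E n → z ∈ K n z := fun n z hz => ⟨hz.1, by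
    simp only [sub_self, norm_zero]; exact (hr0 n).trans (hRr n)⟩
  have hKeq : ∀ n z z', z ∈ E n → z' ∈ E n → ‖z - z'‖ ≤ R n → K n z ⊆ K n z' := by
    intro n z z' hz hz' h y hy
    refine ⟨hy.1, ?_⟩
    have h1 := hsep n z hz z' hz' h
    have h2 := norm_sub_le_of_mem_sparse_diff hz hy.1 hy.2
    have h3 := norm_sub_le_norm_sub_add_norm_sub z' z y
    rw [norm_sub_rev z' z] at h3
    linarith [hs.two_r_le n]
  have ha_ge : ∀ n z i, z ∈ E n → L i z ≤ a n z i := fun n z i hz =>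
    le_csSup (hKfin n z i).bddAbove ⟨z, hzK n z hz, rfl⟩
  have ha_le : ∀ n z i, z ∈ E n → a n z i ≤ L i z + C * r n := by
    intro n z i hz
    refine csSup_le ⟨_, z, hzK n z hz, rfl⟩ ?_
    rintro _ ⟨y, hy, rfl⟩
    have h2 := norm_sub_le_of_mem_sparse_diff hz hy.1 hy.2
    have h1 : L i y - L i z ≤ C * r n := by
      rw [← map_sub]
      refine (le_abs_self _).trans ((hC _ _).trans (mul_le_mul_of_nonneg_left ?_ hs.C_nonneg))
      rwa [norm_sub_rev]
    linarith
  let W₀ : ℕ → V → Set V := fun n z => {x | ∀ i, L i x ≤ F i n (a n z i) x}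
  -- A wall exceeds `L i z` by at most `C * r n` for the cluster width plus `r n` for the bulge,
  -- whence `c₀ * D = C + 1`.
  have hloc : ∀ n z x, z ∈ E n → x ∈ W₀ n z → ‖x - z‖ ≤ D * r n := by
    intro n z x hz hx
    have h1 : c₀ * ‖x - z‖ ≤ (C + 1) * r n := by
      refine hc _ _ (mul_nonneg (by linarith [hs.C_nonneg]) (hr0 n)) fun i => ?_
      rw [map_sub]
      have h1 := hx i
      have h2 := hFle i n (a n z i) x
      have h3 := ha_le n z i hz
      linarith
    rw [← hs.D_eq, mul_assoc] at h1
    exact le_of_mul_le_mul_left h1 hs.c₀_pos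
  refine ⟨{x | ∃ n, ∃ z ∈ E n, x ∈ W₀ n z}, ?_, ?_, ?_⟩
  · intro x hx
    obtain ⟨n, hn⟩ := exists_mem_sparse_diff (R := R) hs.tendsto_r hA hx
    exact ⟨n, x, hn, fun i => (ha_ge n x i hn).trans (hFge i n _ x)⟩
  · intro X hXne hXR hXL x hxX
    by_contra hxW
    obtain ⟨N, hN⟩ := sparse_eventually_empty (R := R) hs.tendsto_r hA
    let P : ℕ → Prop := fun n => ∃ y ∈ X, ∃ z ∈ E n, x + y ∈ W₀ n z
    have hPb : ∀ n, P n → n ≤ N := by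
      rintro n ⟨y, -, z, hz, -⟩
      by_contra! h
      have := hz.1
      rw [hN n h.le] at this
      exact this
    obtain ⟨y₁, hy₁⟩ := hXne
    obtain ⟨n₁, z₁, hz₁, hW₁⟩ := hxX y₁ hy₁
    classical
    -- The largest level of a droplet meeting `x + X`; its wall `i` that excludes `x` will be
    -- contradicted.
    set n := Nat.findGreatest P N with hn
    have hPn₁ : P n₁ := ⟨y₁, hy₁, z₁, hz₁, hW₁⟩
    have hPn : P n := Nat.findGreatest_spec (hPb n₁ hPn₁) hPn₁
    have hmax : ∀ m, P m → m ≤ n := fun m hm => Nat.le_findGreatest (hPb m hm) hm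
    obtain ⟨y₀, hy₀, z₀, hz₀, hW₀⟩ := hPn
    have hx₀ : x ∉ W₀ n z₀ := fun h => hxW ⟨n, z₀, hz₀, h⟩
    simp only [W₀, Set.mem_ofPred_eq, not_forall, not_le] at hx₀
    obtain ⟨i, hi⟩ := hx₀
    obtain ⟨y, hy, hyδ⟩ := hXL i
    obtain ⟨m, z, hz, hW⟩ := hxX y hy
    have hmn := hmax m ⟨y, hy, z, hz, hW⟩
    set G := F i n (a n z₀ i) with hG
    have hGlip : ∀ x y, G x ≤ G y + ε * ‖x - y‖ := hFlip i n (a n z₀ i)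
    have hyR := hXR y hy
    have hy₀R := hXR y₀ hy₀
    rcases hmn.lt_or_eq with hlt | rfl
    -- Smaller droplet: `z` is near `x + y₀`, inside the large one, so `z` lies `τ * r m` below the
    -- wall. By the choice of `τ`, this margin also covers `x`.
    · have d1 : ‖x + y - z‖ ≤ D * r m := hloc m z _ hz hW
      have hRg : 2 * Rg ≤ 2 * Rg * r m :=
        le_mul_of_one_le_right (by linarith [hs.Rg_nonneg]) (hs.one_le_r m)
      have d2 : ‖z - (x + y₀)‖ ≤ (D + 2 * Rg) * r m := by
        have : z - (x + y₀) = -(x + y - z) + y - y₀ := by abel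
        rw [this]
        have h1 := norm_sub_le (-(x + y - z) + y) y₀
        have h2 := norm_add_le (-(x + y - z)) y
        rw [norm_neg] at h2
        linarith
      have d3 : ‖x - z‖ ≤ (D + 2 * Rg) * r m := by
        have : x - z = (x + y - z) - y := by abel
        rw [this]
        have h1 := norm_sub_le (x + y - z) y
        linarith [norm_nonneg y]
      have hCε : 0 ≤ C + ε := add_nonneg hs.C_nonneg hε0
      have hτm : τ * r m = (C + ε) * ((D + 2 * Rg) * r m) := by rw [hs.τ_eq]; ring
      have h1 : L i z ≤ G z + τ * r m := by
        have h2 : L i z - L i (x + y₀) ≤ C * ‖z - (x + y₀)‖ := by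
          rw [← map_sub]; exact (le_abs_self _).trans (hC _ _)
        have h3 := hW₀ i
        have h4 := hGlip (x + y₀) z
        rw [norm_sub_rev] at h4
        have h5 := mul_le_mul_of_nonneg_left d2 hCε
        change L i (x + y₀) ≤ G (x + y₀) at h3
        linarith
      have h2 := hFcl i n (a n z₀ i) m hlt z hz h1
      have h3 : L i x - L i z ≤ C * ‖x - z‖ := by
        rw [← map_sub]; exact (le_abs_self _).trans (hC _ _)
      have h4 := hGlip z x
      rw [norm_sub_rev] at h4
      have h5 := mul_le_mul_of_nonneg_left d3 hCε
      change _ ≤ G z at h2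
      linarith
    -- Same level: `z` and `z₀` share a cluster, hence a wall. From `x` to `x + y`, `L i` gains at
    -- least `δ` and the wall at most `ε * Rg ≤ δ`.
    · have d1 := hloc n z _ hz hW
      have d2 := hloc n z₀ _ hz₀ hW₀
      have d3 : ‖z - z₀‖ ≤ R n := by
        have : z - z₀ = -(x + y - z) + y - y₀ + (x + y₀ - z₀) := by abel
        rw [this]
        have h1 := norm_sub_le (-(x + y - z) + y) y₀
        have h2 := norm_add_le (-(x + y - z)) y
        have h3 := norm_add_le (-(x + y - z) + y - y₀) (x + y₀ - z₀)
        rw [norm_neg] at h2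
        linarith [hs.sep n]
      have hK : K n z = K n z₀ := (hKeq n z z₀ hz hz₀ d3).antisymm
        (hKeq n z₀ z hz₀ hz (by rwa [norm_sub_rev]))
      have ha : a n z i = a n z₀ i := by simp only [a, hK]
      have h1 := hW i
      rw [ha] at h1
      change L i (x + y) ≤ G (x + y) at h1
      have h2 := hGlip (x + y) x
      rw [add_sub_cancel_left] at h2
      rw [map_add] at h1
      have h3 := mul_le_mul_of_nonneg_left hyR hε0
      linarith
  · rintro x ⟨n, z, hz, hx⟩
    exact ⟨n, z, hz.1, hloc n z x hz hx⟩

end ClosedSets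

/-! ### Good directions from subcriticality -/

section Geometry

variable {d : ℕ}

theorem infectedAt_subset_uClosure (U : UpdateFamily d) (A : Set (Fin d → ℤ)) (t : ℕ) :
    infectedAt U A t ⊆ uClosure U A := Set.subset_iUnion _ t

/-- Otherwise `X` would lie in the half-space and infect the origin, which is outside it. -/
theorem exists_inner_pos_of_mem_stableSet {U : UpdateFamily d} {u : UnitSphere d}
    (hu : u ∈ stableSet U) {X : Finset (Fin d → ℤ)} (hX : X ∈ U.rules)
    (hne : ∀ y ∈ X, inner ℝ (toEuclid y) (u : EuclideanSpace ℝ (Fin d)) ≠ 0) :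
    ∃ y ∈ X, 0 < inner ℝ (toEuclid y) (u : EuclideanSpace ℝ (Fin d)) := by
  by_contra! h
  have h0 : (0 : Fin d → ℤ) ∈ uClosure U (halfSpace u) := by
    refine infectedAt_subset_uClosure U _ 1 (Or.inr ⟨X, hX, fun y hy => ?_⟩)
    rw [zero_add]
    exact lt_of_le_of_ne (h y hy) (hne y hy)
  have hst : uClosure U (halfSpace u) = halfSpace u := hu
  rw [hst] at h0
  have h1 : inner ℝ (toEuclid (0 : Fin d → ℤ)) (u : EuclideanSpace ℝ (Fin d)) < 0 := h0
  have h2 : toEuclid (0 : Fin d → ℤ) = 0 := by ext i; simp [toEuclid]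
  rw [h2, inner_zero_left] at h1
  exact lt_irrefl _ h1

theorem dense_inner_ne_zero {E : Type*} [NormedAddCommGroup E] [InnerProductSpace ℝ E]
    {y : E} (hy : y ≠ 0) : Dense {x : E | inner ℝ y x ≠ 0} := by
  have hne : innerSL ℝ y ≠ 0 := by
    intro h
    have h1 : innerSL ℝ y y = 0 := by rw [h]; rfl
    rw [innerSL_apply_apply] at h1
    exact hy (inner_self_eq_zero.1 h1)
  exact (dense_compl_singleton (0 : ℝ)).preimage ((innerSL ℝ y).isOpenMap_of_ne_zero hne)

/-- The open cone over `O` meets the complement of finitely many hyperplanes, which is dense. -/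
theorem exists_mem_inner_ne_zero {O : Set (UnitSphere d)} (hO : IsOpen O) (hne : O.Nonempty)
    (Y : Finset (EuclideanSpace ℝ (Fin d))) (hY : ∀ y ∈ Y, y ≠ 0) :
    ∃ u ∈ O, ∀ y ∈ Y, inner ℝ y (u : EuclideanSpace ℝ (Fin d)) ≠ 0 := by
  obtain ⟨O', hO', rfl⟩ := isOpen_induced_iff.1 hO
  obtain ⟨v, hv⟩ := hne
  have hvn : ‖(v : EuclideanSpace ℝ (Fin d))‖ = 1 := mem_sphere_zero_iff_norm.1 v.2
  have hcont : ContinuousOn (fun x : EuclideanSpace ℝ (Fin d) => ‖x‖⁻¹ • x) {0}ᶜ :=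
    (continuousOn_id.norm.inv₀ fun x hx => norm_ne_zero_iff.2 hx).smul continuousOn_id
  have hopen := hcont.isOpen_inter_preimage isOpen_compl_singleton hO'
  have hdense : Dense (⋂ y ∈ (Y : Set (EuclideanSpace ℝ (Fin d))),
      {x : EuclideanSpace ℝ (Fin d) | inner ℝ y x ≠ 0}) := by
    refine dense_biInter_of_isOpen (fun y _ => ?_) Y.countable_toSet
      fun y hy => dense_inner_ne_zero (hY y hy)
    exact isOpen_ne_fun (by fun_prop) continuous_const
  obtain ⟨x, ⟨hx0, hxO⟩, hx⟩ := hdense.inter_open_nonempty _ hopen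
    ⟨(v : EuclideanSpace ℝ (Fin d)), by
      intro h
      rw [Set.mem_singleton_iff] at h
      rw [h, norm_zero] at hvn
      exact zero_ne_one hvn, by
      simpa [hvn] using hv⟩
  have hx0' : ‖x‖ ≠ 0 := norm_ne_zero_iff.2 hx0
  refine ⟨⟨‖x‖⁻¹ • x, ?_⟩, hxO, fun y hy => ?_⟩
  · rw [mem_sphere_zero_iff_norm, norm_smul, norm_inv, norm_norm, inv_mul_cancel₀ hx0']
  · have := Set.mem_iInter₂.1 hx y hy
    rw [inner_smul_right]
    exact mul_ne_zero (inv_ne_zero hx0') this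

theorem IsSubcritical.exists_direction {U : UpdateFamily d} (hU : IsSubcritical U)
    (w : UnitSphere d) : ∃ u : UnitSphere d,
      0 < inner ℝ (w : EuclideanSpace ℝ (Fin d)) (u : EuclideanSpace ℝ (Fin d)) ∧
      ∀ X ∈ U.rules, ∃ y ∈ X, 0 < inner ℝ (toEuclid y) (u : EuclideanSpace ℝ (Fin d)) := by
  classical
  obtain ⟨u, hu, hne⟩ := exists_mem_inner_ne_zero isOpen_interior (hU w)
    (U.rules.biUnion fun X => X.image toEuclid) (by
      intro y hy
      simp only [Finset.mem_biUnion, Finset.mem_image] at hy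
      obtain ⟨X, hX, x, hx, rfl⟩ := hy
      intro h
      have : x = 0 := by
        ext i
        have := congrArg (fun v : EuclideanSpace ℝ (Fin d) => v i) h
        simpa [toEuclid] using this
      exact U.zero_notMem X hX (this ▸ hx))
  have hmem := interior_subset hu
  refine ⟨u, hmem.1, fun X hX => exists_inner_pos_of_mem_stableSet hmem.2 hX fun y hy => hne _ ?_⟩
  exact Finset.mem_biUnion.2 ⟨X, hX, Finset.mem_image_of_mem _ hy⟩

theorem exists_pos_le_of_finset {α : Type*} (s : Finset α) (f : α → ℝ) (hf : ∀ a ∈ s, 0 < f a) :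
    ∃ δ > 0, ∀ a ∈ s, δ ≤ f a := by
  rcases s.eq_empty_or_nonempty with rfl | hs
  · exact ⟨1, one_pos, by simp⟩
  · obtain ⟨a, ha, h⟩ := s.exists_min_image f hs
    exact ⟨f a, hf a ha, h⟩

theorem norm_le_norm_toEuclid (x : Fin d → ℤ) : ‖x‖ ≤ ‖toEuclid x‖ := by
  refine (pi_norm_le_iff_of_nonneg (norm_nonneg _)).2 fun i => ?_
  have := PiLp.norm_apply_le (toEuclid x) i
  simpa [toEuclid, Int.norm_eq_abs] using this

theorem norm_toEuclid_le (x : Fin d → ℤ) : ‖toEuclid x‖ ≤ d * ‖x‖ := by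
  have h : toEuclid x = ∑ i, (x i : ℝ) • EuclideanSpace.single i (1 : ℝ) := by
    ext j
    simp [toEuclid, Finset.sum_apply, Pi.single_apply]
  rw [h]
  refine (norm_sum_le _ _).trans ?_
  have : ∀ i ∈ (Finset.univ : Finset (Fin d)),
      ‖(x i : ℝ) • EuclideanSpace.single i (1 : ℝ)‖ ≤ ‖x‖ := by
    intro i _
    have := norm_le_pi_norm x i
    rw [norm_smul]
    simpa [Int.norm_eq_abs] using this
  simpa using Finset.sum_le_sum this

/-- The linear functional `⟨·, u⟩` on `ℤ^d`. -/
noncomputable def innerHom (u : UnitSphere d) : (Fin d → ℤ) →+ ℝ where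
  toFun x := inner ℝ (toEuclid x) (u : EuclideanSpace ℝ (Fin d))
  map_zero' := by
    have h2 : toEuclid (0 : Fin d → ℤ) = 0 := by ext i; simp [toEuclid]
    rw [h2, inner_zero_left]
  map_add' x y := by
    have h2 : toEuclid (x + y) = toEuclid x + toEuclid y := by ext i; simp [toEuclid]
    rw [h2, inner_add_left]

theorem innerHom_apply (u : UnitSphere d) (x : Fin d → ℤ) :
    innerHom u x = inner ℝ (toEuclid x) (u : EuclideanSpace ℝ (Fin d)) := rfl

theorem abs_innerHom_le (u : UnitSphere d) (x : Fin d → ℤ) : |innerHom u x| ≤ d * ‖x‖ := by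
  have h := abs_real_inner_le_norm (toEuclid x) (u : EuclideanSpace ℝ (Fin d))
  rw [mem_sphere_zero_iff_norm.1 u.2, mul_one] at h
  exact h.trans (norm_toEuclid_le x)

/-- A direction good for `w` stays good near `w`, so compactness of the sphere leaves finitely many
directions; finiteness of the rules makes `δ` uniform. -/
theorem IsSubcritical.exists_directions {U : UpdateFamily d} (hU : IsSubcritical U) :
    ∃ (I : Finset (UnitSphere d)) (c₀ δ : ℝ), 0 < c₀ ∧ 0 < δ ∧
      (∀ x t, 0 ≤ t → (∀ u : I, innerHom u.1 x ≤ t) → c₀ * ‖x‖ ≤ t) ∧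
      ∀ X ∈ U.rules, ∀ u : I, ∃ y ∈ X, δ ≤ innerHom u.1 y := by
  classical
  choose f hf hfX using hU.exists_direction
  let V : UnitSphere d → Set (UnitSphere d) := fun w =>
    {w' | inner ℝ (w : EuclideanSpace ℝ (Fin d)) (f w : EuclideanSpace ℝ (Fin d)) / 2 <
      inner ℝ (w' : EuclideanSpace ℝ (Fin d)) (f w : EuclideanSpace ℝ (Fin d))}
  have : CompactSpace (UnitSphere d) := isCompact_iff_compactSpace.1 (isCompact_sphere _ _)
  obtain ⟨T, hT⟩ := (isCompact_univ : IsCompact (Set.univ : Set (UnitSphere d))).elim_finite_subcover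
    V (fun w => isOpen_lt continuous_const (by fun_prop))
    (fun w _ => Set.mem_iUnion.2 ⟨w, half_lt_self (hf w)⟩)
  obtain ⟨c₀, hc₀, hc⟩ := exists_pos_le_of_finset T
    (fun w => inner ℝ (w : EuclideanSpace ℝ (Fin d)) (f w : EuclideanSpace ℝ (Fin d)) / 2)
    (fun w _ => half_pos (hf w))
  have hex : ∀ q : Finset (Fin d → ℤ) × UnitSphere d, ∃ y, q ∈ U.rules ×ˢ (T.image f) →
      y ∈ q.1 ∧ 0 < innerHom q.2 y := by
    rintro ⟨X, u⟩
    by_cases h : (X, u) ∈ U.rules ×ˢ (T.image f)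
    · obtain ⟨hX, hu⟩ := Finset.mem_product.1 h
      obtain ⟨w, -, rfl⟩ := Finset.mem_image.1 hu
      obtain ⟨y, hy, hpos⟩ := hfX w X hX
      exact ⟨y, fun _ => ⟨hy, hpos⟩⟩
    · exact ⟨0, fun h' => absurd h' h⟩
  choose g hg using hex
  obtain ⟨δ, hδ, hδg⟩ := exists_pos_le_of_finset (U.rules ×ˢ (T.image f))
    (fun q => innerHom q.2 (g q)) (fun q hq => (hg q hq).2)
  refine ⟨T.image f, c₀, δ, hc₀, hδ, fun x t ht hx => ?_, fun X hX u => ?_⟩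
  · rcases eq_or_ne x 0 with rfl | hx0
    · simpa using ht
    have hpos : 0 < ‖toEuclid x‖ := (norm_pos_iff.2 hx0).trans_le (norm_le_norm_toEuclid x)
    let w : UnitSphere d := ⟨‖toEuclid x‖⁻¹ • toEuclid x, by
      rw [mem_sphere_zero_iff_norm, norm_smul, norm_inv, norm_norm, inv_mul_cancel₀ hpos.ne']⟩
    obtain ⟨v, hvT, hv⟩ := Set.mem_iUnion₂.1 (hT (Set.mem_univ w))
    have h1 := hx ⟨f v, Finset.mem_image_of_mem f hvT⟩
    have h2 : inner ℝ (v : EuclideanSpace ℝ (Fin d)) (f v : EuclideanSpace ℝ (Fin d)) / 2 <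
      inner ℝ (‖toEuclid x‖⁻¹ • toEuclid x) (f v : EuclideanSpace ℝ (Fin d)) := hv
    have h3 := (hc v hvT).trans_lt h2
    rw [real_inner_smul_left, ← div_eq_inv_mul, lt_div_iff₀ hpos] at h3
    rw [innerHom_apply] at h1
    have h4 := mul_le_mul_of_nonneg_left (norm_le_norm_toEuclid x) hc₀.le
    linarith
  · have hq : (X, (u : UnitSphere d)) ∈ U.rules ×ˢ (T.image f) := Finset.mk_mem_product hX u.2
    exact ⟨_, (hg _ hq).1, hδg _ hq⟩

theorem IsSubcritical.rules_nonempty {U : UpdateFamily d} (hd : 1 ≤ d) (hU : IsSubcritical U)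
    {X : Finset (Fin d → ℤ)} (hX : X ∈ U.rules) : X.Nonempty := by
  let w : UnitSphere d := ⟨EuclideanSpace.single ⟨0, hd⟩ 1, by simp⟩
  obtain ⟨u, -, hu⟩ := hU.exists_direction w
  obtain ⟨y, hy, -⟩ := hu X hX
  exact ⟨y, hy⟩

end Geometry

/-! ### Monotonicity and finite dependence of the dynamics -/

section Closure

variable {d : ℕ}

theorem infectedAt_mono (U : UpdateFamily d) {A B : Set (Fin d → ℤ)} (h : A ⊆ B) (t : ℕ) :
    infectedAt U A t ⊆ infectedAt U B t := by
  induction t with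
  | zero => exact h
  | succ t ih =>
    rintro x (hx | ⟨X, hX, hx⟩)
    · exact Or.inl (ih hx)
    · exact Or.inr ⟨X, hX, fun y hy => ih (hx y hy)⟩

/-- Reduces to finite initial sets, on which the cluster hierarchy terminates. -/
theorem exists_finite_infectedAt (U : UpdateFamily d) (A : Set (Fin d → ℤ)) (t : ℕ) :
    ∀ x ∈ infectedAt U A t, ∃ B ⊆ A, B.Finite ∧ x ∈ infectedAt U B t := by
  induction t with
  | zero => exact fun x hx => ⟨{x}, Set.singleton_subset_iff.2 hx, Set.finite_singleton x, rfl⟩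
  | succ t ih =>
    rintro x (hx | ⟨X, hX, hx⟩)
    · obtain ⟨B, hB, hf, h⟩ := ih x hx
      exact ⟨B, hB, hf, Or.inl h⟩
    · choose B hB hf h using fun y : X => ih (x + y) (hx y y.2)
      refine ⟨⋃ y, B y, Set.iUnion_subset hB, Set.finite_iUnion hf, Or.inr ⟨X, hX, fun y hy => ?_⟩⟩
      exact infectedAt_mono U (Set.subset_iUnion B ⟨y, hy⟩) t (h ⟨y, hy⟩)

theorem uClosure_subset {U : UpdateFamily d} {A W : Set (Fin d → ℤ)} (hA : A ⊆ W)
    (hW : ∀ X ∈ U.rules, ∀ x, (∀ y ∈ X, x + y ∈ W) → x ∈ W) : uClosure U A ⊆ W := by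
  refine Set.iUnion_subset fun t => ?_
  induction t with
  | zero => exact hA
  | succ t ih =>
    rintro x (hx | ⟨X, hX, hx⟩)
    · exact ih hx
    · exact hW X hX x fun y hy => ih (hx y hy)

end Closure

/-! ### Counting witnesses of sparse points -/

section Counting

variable {d : ℕ}

/-- The ball of radius `N` around `x` in `ℤ^d`, for the sup norm. -/
noncomputable def ballFinset (x : Fin d → ℤ) (N : ℕ) : Finset (Fin d → ℤ) :=
  Finset.Icc (fun i => x i - N) (fun i => x i + N)

theorem mem_ballFinset {x y : Fin d → ℤ} {N : ℕ} : y ∈ ballFinset x N ↔ ‖x - y‖ ≤ N := by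
  rw [ballFinset, Finset.mem_Icc, pi_norm_le_iff_of_nonneg (Nat.cast_nonneg N), Pi.le_def,
    Pi.le_def, ← forall_and]
  refine forall_congr' fun i => ?_
  have hN : (N : ℝ) = ((N : ℤ) : ℝ) := by simp
  rw [Pi.sub_apply, Int.norm_eq_abs, ← Int.cast_abs, hN, Int.cast_le, abs_le]
  omega

theorem card_ballFinset (x : Fin d → ℤ) (N : ℕ) : (ballFinset x N).card = (2 * N + 1) ^ d := by
  rw [ballFinset, Pi.card_Icc]
  have : ∀ i ∈ (Finset.univ : Finset (Fin d)),
      (Finset.Icc (x i - (N : ℤ)) (x i + N)).card = 2 * N + 1 := by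
    intro i _
    rw [Int.card_Icc]
    omega
  rw [Finset.prod_congr rfl this]
  simp

/-- The diameters of the clusters of each level. -/
noncomputable def radius (Q n : ℕ) : ℝ := (Q : ℝ) ^ (n * (n + 1))

/-- The isolation distances of the clusters of each level. -/
noncomputable def isolation (Q n : ℕ) : ℝ := (Q : ℝ) ^ ((n + 1) ^ 2)

theorem isolation_eq (Q n : ℕ) : isolation Q n = (Q : ℝ) ^ (n + 1) * radius Q n := by
  rw [isolation, radius, ← pow_add]; ring_nf

theorem radius_succ (Q n : ℕ) : radius Q (n + 1) = (Q : ℝ) ^ (n + 1) * isolation Q n := by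
  rw [isolation, radius, ← pow_add]; ring_nf

theorem one_le_radius {Q : ℕ} (hQ : 1 ≤ Q) (n : ℕ) : 1 ≤ radius Q n :=
  one_le_pow₀ (by exact_mod_cast hQ)

theorem mul_radius_le_isolation {Q : ℕ} (hQ : 1 ≤ Q) (n : ℕ) :
    (Q : ℝ) * radius Q n ≤ isolation Q n := by
  rw [isolation_eq]
  have h1 : (1 : ℝ) ≤ Q := by exact_mod_cast hQ
  have := one_le_radius hQ n
  exact mul_le_mul_of_nonneg_right (le_self_pow₀ h1 n.succ_ne_zero) (by linarith)

theorem mul_isolation_le_radius {Q : ℕ} (hQ : 1 ≤ Q) (n : ℕ) :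
    (Q : ℝ) * isolation Q n ≤ radius Q (n + 1) := by
  rw [radius_succ]
  have h1 : (1 : ℝ) ≤ Q := by exact_mod_cast hQ
  exact mul_le_mul_of_nonneg_right (le_self_pow₀ h1 n.succ_ne_zero) (by unfold isolation; positivity)

theorem card_ballFinset_isolation_le {Q : ℕ} (hQ : 3 ≤ Q) (x : Fin d → ℤ) (n : ℕ) :
    (ballFinset x (Q ^ ((n + 1) ^ 2))).card ≤ Q ^ (d * (n ^ 2 + 2 * n + 2)) := by
  rw [card_ballFinset, mul_comm d, pow_mul]
  refine Nat.pow_le_pow_left ?_ d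
  have h1 : 1 ≤ Q ^ ((n + 1) ^ 2) := Nat.one_le_pow _ _ (by omega)
  calc 2 * Q ^ ((n + 1) ^ 2) + 1 ≤ 3 * Q ^ ((n + 1) ^ 2) := by omega
    _ ≤ Q * Q ^ ((n + 1) ^ 2) := Nat.mul_le_mul_right _ hQ
    _ = Q ^ (n ^ 2 + 2 * n + 2) := by rw [← pow_succ']; ring_nf

/-- Membership in the `n`-th sparse subset is witnessed by one of few possible sets of `2 ^ n`
points. -/
theorem exists_sparse_witnesses {Q : ℕ} (hQ : 3 ≤ Q) (n : ℕ) : ∀ x : Fin d → ℤ,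
    ∃ T : Finset (Finset (Fin d → ℤ)),
      T.card * Q ^ (d * (n ^ 2 + 4 * n + 7)) ≤ Q ^ (7 * d * 2 ^ n) ∧
      (∀ S ∈ T, S.card = 2 ^ n ∧ ∀ s ∈ S, 2 * ‖x - s‖ ≤ radius Q n) ∧
      ∀ A : Set (Fin d → ℤ), x ∈ sparse (radius Q) (isolation Q) A n → ∃ S ∈ T, ↑S ⊆ A := by
  classical
  induction n with
  | zero =>
    intro x
    refine ⟨{{x}}, ?_, ?_, fun A hx => ⟨{x}, by simp, by simpa [sparse] using hx⟩⟩
    · simp [mul_comm]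
    · intro S hS
      rw [Finset.mem_singleton] at hS
      subst hS
      simp [radius]
  | succ n ih =>
    intro x
    choose T hT₁ hT₂ hT₃ using ih
    have hQ1 : 1 ≤ Q := by omega
    set B := ballFinset x (Q ^ ((n + 1) ^ 2)) with hB
    refine ⟨((T x ×ˢ B.biUnion T).image fun q => q.1 ∪ q.2).filter fun S =>
      S.card = 2 ^ (n + 1) ∧ ∀ s ∈ S, 2 * ‖x - s‖ ≤ radius Q (n + 1), ?_,
      fun S hS => (Finset.mem_filter.1 hS).2, ?_⟩
    · have hpos : 0 < Q ^ (d * (n ^ 2 + 4 * n + 7)) := pow_pos (by omega) _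
      have hpow : Q ^ (7 * d * 2 ^ (n + 1)) = Q ^ (7 * d * 2 ^ n) * Q ^ (7 * d * 2 ^ n) := by
        rw [← pow_add]; ring_nf
      -- The number of witnesses is at most squared and multiplied by the ball size. The exponent `n
      -- ^ 2 + 4 * n + 7` is chosen to make this recursion close exactly.
      have hpow' : Q ^ (d * (n ^ 2 + 2 * n + 2)) * Q ^ (d * ((n + 1) ^ 2 + 4 * (n + 1) + 7)) =
          Q ^ (d * (n ^ 2 + 4 * n + 7)) * Q ^ (d * (n ^ 2 + 4 * n + 7)) := by
        rw [← pow_add, ← pow_add]; ring_nf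
      set M := Q ^ (7 * d * 2 ^ n) / Q ^ (d * (n ^ 2 + 4 * n + 7)) with hM
      have hTM : ∀ y, (T y).card ≤ M := fun y => (Nat.le_div_iff_mul_le hpos).2 (hT₁ y)
      have hMle : M * Q ^ (d * (n ^ 2 + 4 * n + 7)) ≤ Q ^ (7 * d * 2 ^ n) :=
        Nat.div_mul_le_self _ _
      have hc : (((T x ×ˢ B.biUnion T).image fun q => q.1 ∪ q.2).filter fun S =>
          S.card = 2 ^ (n + 1) ∧ ∀ s ∈ S, 2 * ‖x - s‖ ≤ radius Q (n + 1)).card ≤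
          M * (Q ^ (d * (n ^ 2 + 2 * n + 2)) * M) := by
        refine (Finset.card_filter_le _ _).trans (Finset.card_image_le.trans ?_)
        rw [Finset.card_product]
        refine Nat.mul_le_mul (hTM x) (Finset.card_biUnion_le_card_mul _ _ _ (fun y _ => hTM y)
          |>.trans (Nat.mul_le_mul_right _ (card_ballFinset_isolation_le hQ x n)))
      calc _ ≤ M * (Q ^ (d * (n ^ 2 + 2 * n + 2)) * M) *
            Q ^ (d * ((n + 1) ^ 2 + 4 * (n + 1) + 7)) := Nat.mul_le_mul_right _ hc
        _ = M * M * (Q ^ (d * (n ^ 2 + 2 * n + 2)) *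
            Q ^ (d * ((n + 1) ^ 2 + 4 * (n + 1) + 7))) := by ring
        _ = (M * Q ^ (d * (n ^ 2 + 4 * n + 7))) * (M * Q ^ (d * (n ^ 2 + 4 * n + 7))) := by
            rw [hpow']; ring
        _ ≤ _ := by rw [hpow]; exact Nat.mul_le_mul hMle hMle
    · rintro A ⟨hx, y, hy, hlt, hle⟩
      obtain ⟨S₁, hS₁, hA₁⟩ := hT₃ x A hx
      obtain ⟨S₂, hS₂, hA₂⟩ := hT₃ y A hy
      obtain ⟨hc₁, hr₁⟩ := hT₂ x S₁ hS₁
      obtain ⟨hc₂, hr₂⟩ := hT₂ y S₂ hS₂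
      have hyB : y ∈ B := by
        rw [hB, mem_ballFinset]
        push_cast
        exact hle
      refine ⟨S₁ ∪ S₂, Finset.mem_filter.2 ⟨Finset.mem_image.2 ⟨(S₁, S₂), Finset.mk_mem_product hS₁
        (Finset.mem_biUnion.2 ⟨y, hyB, hS₂⟩), rfl⟩, ?_, ?_⟩, ?_⟩
      -- The two witness sets lie within `radius Q n / 2` of `x` and `y`, which are farther apart
      -- than `radius Q n`.
      · rw [Finset.card_union_of_disjoint, hc₁, hc₂, pow_succ, mul_two]
        refine Finset.disjoint_left.2 fun s h₁ h₂ => ?_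
        have g₁ := hr₁ s h₁
        have g₂ := hr₂ s h₂
        have g₃ := norm_sub_le_norm_sub_add_norm_sub x s y
        rw [norm_sub_rev s y] at g₃
        linarith
      · have hQ3 : (3 : ℝ) ≤ Q := by exact_mod_cast hQ
        have hr := one_le_radius hQ1 n
        have h1 := mul_radius_le_isolation hQ1 n
        have h2 := mul_isolation_le_radius hQ1 n
        have h3 : radius Q n ≤ isolation Q n := by nlinarith
        have h4 : 3 * isolation Q n ≤ radius Q (n + 1) := by nlinarith
        intro s hs
        rcases Finset.mem_union.1 hs with hs | hs
        · linarith [hr₁ s hs]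
        · have g₃ := norm_sub_le_norm_sub_add_norm_sub x y s
          linarith [hr₂ s hs]
      · rw [Finset.coe_union]
        exact Set.union_subset hA₁ hA₂

end Counting

/-! ### Probabilities under the site law -/

section Probability

open MeasureTheory

variable {d : ℕ}

instance siteLaw.isProbabilityMeasure (p : unitInterval) :
    IsProbabilityMeasure (siteLaw d p) := by
  unfold siteLaw; infer_instance

theorem siteLaw_superset (p : unitInterval) (S : Finset (Fin d → ℤ)) :
    siteLaw d p {A | ↑S ⊆ A} = ENNReal.ofReal ((p : ℝ) ^ S.card) := by
  have h : (fun q : (Fin d → ℤ) → Prop => {i | q i}) ⁻¹' {A | ↑S ⊆ A} =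
      Set.pi S fun _ => {True} := by
    ext q
    simp [Set.subset_def]
  rw [siteLaw, ProbabilityTheory.setBernoulli_apply', h, Measure.infinitePi_pi]
  · have hp : ENNReal.ofReal p = (unitInterval.toNNReal p : ENNReal) := by
      rw [ENNReal.ofReal, Real.toNNReal_of_nonneg p.2.1]
      rfl
    simp [ENNReal.ofReal_pow p.2.1, hp]
  · simp

theorem half_le_siteLaw_one_univ (U : UpdateFamily d) :
    1 / 2 ≤ (siteLaw d 1).real {A | uClosure U A = Set.univ} := by
  have : uClosure U Set.univ = Set.univ :=
    Set.eq_univ_of_univ_subset (Set.subset_iUnion (fun t => infectedAt U Set.univ t) 0)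
  have h1 : (siteLaw d 1) {A | uClosure U A = Set.univ} = 1 := by
    rw [siteLaw, ProbabilityTheory.setBernoulli_one]
    exact Measure.dirac_apply_of_mem this
  rw [measureReal_def, h1]
  norm_num

end Probability

/-! ### Choice of scales and the union bound -/

section Subcritical

open MeasureTheory

variable {d : ℕ}

theorem exists_scales {C c₀ Rg ε : ℝ} (hC : 0 ≤ C) (hc : 0 < c₀) (hRg : 0 ≤ Rg) (hε : 0 < ε) :
    ∃ (Q : ℕ) (τ D : ℝ) (e : ℕ → ℝ), 3 ≤ Q ∧
      Scales C c₀ Rg ε τ D (radius Q) (isolation Q) e ∧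
      ∀ n, D * radius Q n ≤ isolation Q n := by
  set D : ℝ := (C + 1) / c₀ with hD
  set τ : ℝ := (C + ε) * (D + 2 * Rg) with hτ
  have hD0 : 0 ≤ D := by positivity
  have hτ0 : 0 ≤ τ := by positivity
  obtain ⟨Q, hQ⟩ := exists_nat_ge
    (3 + 4 * (2 * τ + 1 + C + ε) / ε + (2 * τ + 2 + C + ε) + (2 * D + 2 * Rg))
  have hB : 0 ≤ 4 * (2 * τ + 1 + C + ε) / ε := by positivity
  have hQ3' : (3 : ℝ) ≤ Q := by linarith
  have hQ3 : 3 ≤ Q := by exact_mod_cast hQ3'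
  have hQ1 : 1 ≤ Q := by omega
  have hr := one_le_radius hQ1
  have hrR := mul_radius_le_isolation hQ1
  have hRr := mul_isolation_le_radius hQ1
  have hQr : ∀ {t : ℝ} (n : ℕ), t ≤ Q → t * radius Q n ≤ isolation Q n := fun n ht =>
    (mul_le_mul_of_nonneg_right ht (zero_le_one.trans (hr n))).trans (hrR n)
  have hsep : ∀ n, (2 * D + 2 * Rg) * radius Q n ≤ isolation Q n :=
    fun n => hQr n (by linarith)
  -- The slope drops by `ε / 4 * (1 / 2) ^ m` at level `m`, which the ratio `Q ^ (m + 1)` of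
  -- isolation distance to radius outweighs.
  refine ⟨Q, τ, D, fun n => ε * (1 + (1 / 2) ^ n) / 2, hQ3, ?_, fun n => hQr n (by linarith)⟩
  refine ⟨hC, hc, hRg, hr, ?_, fun n => by positivity, ?_, by norm_num,
    mul_div_cancel₀ _ hc.ne', rfl, fun m => ?_, fun m => ?_, fun m => hQr m (by linarith),
    fun m => ?_⟩
  · refine Filter.tendsto_atTop_mono (f := fun n : ℕ => (Q : ℝ) ^ n) (fun n => ?_)
      (tendsto_pow_atTop_atTop_of_one_lt (by linarith))
    exact pow_le_pow_right₀ (by linarith) (Nat.le_mul_of_pos_right n n.succ_pos)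
  · intro m n hmn
    have : (1 / 2 : ℝ) ^ n ≤ (1 / 2) ^ m :=
      pow_le_pow_of_le_one (by norm_num) (by norm_num) hmn
    have := mul_le_mul_of_nonneg_left this hε.le
    change ε * (1 + (1 / 2) ^ n) / 2 ≤ ε * (1 + (1 / 2) ^ m) / 2
    linarith
  · have h1 : ε * (1 + (1 / 2) ^ m) / 2 - ε * (1 + (1 / 2) ^ (m + 1)) / 2 =
        ε / 4 * (1 / 2 : ℝ) ^ m := by ring
    have h2 : (Q : ℝ) ≤ (1 / 2) ^ m * (Q : ℝ) ^ (m + 1) := by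
      rw [pow_succ, ← mul_assoc, ← mul_pow]
      exact le_mul_of_one_le_left (by linarith) (one_le_pow₀ (by linarith))
    have h3 : 4 * (2 * τ + 1 + C + ε) / ε ≤ Q := by linarith
    rw [div_le_iff₀ hε] at h3
    have h4 := mul_le_mul_of_nonneg_left h2 hε.le
    rw [h1, isolation_eq]
    have h5 : (2 * τ + 1 + C + ε) ≤ ε / 4 * (1 / 2 : ℝ) ^ m * (Q : ℝ) ^ (m + 1) := by linarith
    have := mul_le_mul_of_nonneg_right h5 (zero_le_one.trans (hr m))
    linarith
  · have h1 := hQr (t := 2 * τ + 2 + C + ε) m (by linarith)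
    have h2 := hRr m
    have h3 := hr m
    have h4 := hrR m
    have h5 : 0 ≤ isolation Q m := by unfold isolation; positivity
    have h6 : 3 * isolation Q m ≤ Q * isolation Q m := mul_le_mul_of_nonneg_right hQ3' h5
    linarith
  · have h1 := hsep m
    have h2 := mul_le_mul_of_nonneg_left (hr m) (by positivity : 0 ≤ 2 * Rg)
    linarith

/-- If the origin becomes infected, then at some level `n` it is close to the `n`-th sparse subset
of the initial set. -/
theorem IsSubcritical.exists_near_sparse (hd : 1 ≤ d) {U : UpdateFamily d}
    (hU : IsSubcritical U) : ∃ Q : ℕ, 3 ≤ Q ∧ ∀ A : Set (Fin d → ℤ), 0 ∈ uClosure U A →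
      ∃ B ⊆ A, ∃ n, ∃ z ∈ sparse (radius Q) (isolation Q) B n,
        z ∈ ballFinset 0 (Q ^ ((n + 1) ^ 2)) := by
  classical
  obtain ⟨I, c₀, δ, hc₀, hδ, hc, hX⟩ := hU.exists_directions
  obtain ⟨Rg, hRg0, hRg⟩ : ∃ Rg : ℝ, 0 ≤ Rg ∧ ∀ X ∈ U.rules, ∀ y ∈ X, ‖y‖ ≤ Rg := by
    refine ⟨∑ X ∈ U.rules, ∑ y ∈ X, ‖y‖, by positivity, fun X hX y hy => ?_⟩
    calc ‖y‖ ≤ ∑ y ∈ X, ‖y‖ :=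
          Finset.single_le_sum (f := fun y => ‖y‖) (fun _ _ => norm_nonneg _) hy
      _ ≤ _ := Finset.single_le_sum (f := fun X => ∑ y ∈ X, ‖y‖)
          (fun _ _ => Finset.sum_nonneg fun _ _ => norm_nonneg _) hX
  have hε : 0 < δ / (Rg + 1) := by positivity
  have hεR : δ / (Rg + 1) * Rg ≤ δ := by
    rw [div_mul_eq_mul_div, div_le_iff₀ (by positivity)]
    exact mul_le_mul_of_nonneg_left (by linarith) hδ.le
  obtain ⟨Q, τ, D, e, hQ, hs, hDQ⟩ := exists_scales (Nat.cast_nonneg d) hc₀ hRg0 hε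
  refine ⟨Q, hQ, fun A hA => ?_⟩
  obtain ⟨t, ht⟩ := Set.mem_iUnion.1 hA
  obtain ⟨B, hBA, hB, hB0⟩ := exists_finite_infectedAt U A t 0 ht
  obtain ⟨W, hBW, hW, hWs⟩ := exists_closed_superset (L := fun u : I => innerHom u.1) hs
    (fun u => abs_innerHom_le u.1) hc hεR hB
  have h0 := uClosure_subset hBW (fun X hXU => hW X (hU.rules_nonempty hd hXU) (hRg X hXU)
    (hX X hXU)) (infectedAt_subset_uClosure U B t hB0)
  obtain ⟨n, z, hz, hn⟩ := hWs 0 h0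
  refine ⟨B, hBA, n, z, hz, mem_ballFinset.2 ?_⟩
  have := hn.trans (hDQ n)
  rw [isolation] at this
  exact_mod_cast this

theorem siteLaw_near_sparse_le {Q : ℕ} (hQ : 3 ≤ Q) (p : unitInterval) (n : ℕ) :
    siteLaw d p {A | ∃ B ⊆ A, ∃ z ∈ sparse (radius Q) (isolation Q) B n,
      z ∈ ballFinset 0 (Q ^ ((n + 1) ^ 2))} ≤
      ENNReal.ofReal (((Q : ℝ) ^ (7 * d) * p) ^ 2 ^ n) := by
  classical
  choose T hT₁ hT₂ hT₃ using exists_sparse_witnesses (d := d) hQ n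
  set F := (ballFinset (0 : Fin d → ℤ) (Q ^ ((n + 1) ^ 2))).biUnion T with hF
  -- The spare factor in the witness bound pays for the choice of `z` in the ball.
  have hcard : F.card ≤ Q ^ (7 * d * 2 ^ n) := by
    have hpos : 0 < Q ^ (d * (n ^ 2 + 4 * n + 7)) := pow_pos (by omega) _
    calc F.card ≤ _ := Finset.card_biUnion_le_card_mul _ _ _
          (fun y _ => (Nat.le_div_iff_mul_le hpos).2 (hT₁ y))
      _ ≤ Q ^ (d * (n ^ 2 + 4 * n + 7)) * _ := Nat.mul_le_mul_right _
          ((card_ballFinset_isolation_le hQ 0 n).trans (Nat.pow_le_pow_right (by omega)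
            (Nat.mul_le_mul_left d (by omega))))
      _ ≤ _ := Nat.mul_div_le _ _
  have hsub : {A : Set (Fin d → ℤ) | ∃ B ⊆ A, ∃ z ∈ sparse (radius Q) (isolation Q) B n,
      z ∈ ballFinset 0 (Q ^ ((n + 1) ^ 2))} ⊆ ⋃ S ∈ F, {A | ↑S ⊆ A} := by
    rintro A ⟨B, hBA, z, hz, hzb⟩
    obtain ⟨S, hS, hSB⟩ := hT₃ z B hz
    exact Set.mem_iUnion₂.2 ⟨S, Finset.mem_biUnion.2 ⟨z, hzb, hS⟩, hSB.trans hBA⟩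
  have hSF : ∀ S ∈ F, siteLaw d p {A | ↑S ⊆ A} = ENNReal.ofReal ((p : ℝ) ^ 2 ^ n) := by
    intro S hS
    obtain ⟨z, -, hz⟩ := Finset.mem_biUnion.1 hS
    rw [siteLaw_superset, (hT₂ z S hz).1]
  calc _ ≤ ∑ S ∈ F, siteLaw d p {A | ↑S ⊆ A} :=
        (measure_mono hsub).trans (measure_biUnion_finset_le _ _)
    _ = F.card * ENNReal.ofReal ((p : ℝ) ^ 2 ^ n) := by
        rw [Finset.sum_congr rfl hSF, Finset.sum_const, nsmul_eq_mul]
    _ = ENNReal.ofReal (F.card * (p : ℝ) ^ 2 ^ n) := by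
        rw [ENNReal.ofReal_mul (Nat.cast_nonneg _), ENNReal.ofReal_natCast]
    _ ≤ _ := by
        refine ENNReal.ofReal_le_ofReal ?_
        rw [mul_pow, ← pow_mul]
        refine mul_le_mul_of_nonneg_right ?_ (pow_nonneg p.2.1 _)
        exact_mod_cast hcard

/-- For a subcritical update family, the origin becomes infected with probability `O(p)`. -/
theorem IsSubcritical.exists_siteLaw_le (hd : 1 ≤ d) {U : UpdateFamily d}
    (hU : IsSubcritical U) : ∃ C : ℝ, 0 < C ∧ ∀ p : unitInterval,
      (siteLaw d p).real {A | (0 : Fin d → ℤ) ∈ uClosure U A} ≤ C * p := by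
  obtain ⟨Q, hQ, hnear⟩ := hU.exists_near_sparse hd
  have hΛ : (0 : ℝ) < (Q : ℝ) ^ (7 * d) := by
    have : (0 : ℝ) < Q := by exact_mod_cast (by omega : 0 < Q)
    positivity
  set Λ : ℝ := (Q : ℝ) ^ (7 * d) with hΛdef
  refine ⟨2 * Λ, by positivity, fun p => ?_⟩
  have hp0 : (0 : ℝ) ≤ p := p.2.1
  -- For `Λ * p > 1 / 2` the claimed bound exceeds `1`; otherwise the series is dominated by a
  -- geometric one.
  rcases le_or_gt (Λ * p) (1 / 2) with hp | hp
  swap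
  · exact measureReal_le_one.trans (by linarith)
  have hterm : ∀ n : ℕ, (Λ * p) ^ 2 ^ n ≤ Λ * p * (1 / 2) ^ n := by
    intro n
    have hx : 0 ≤ Λ * p := by positivity
    calc (Λ * p) ^ 2 ^ n ≤ (Λ * p) ^ (n + 1) :=
          pow_le_pow_of_le_one hx (by linarith) Nat.lt_two_pow_self
      _ = Λ * p * (Λ * p) ^ n := pow_succ' _ _
      _ ≤ _ := mul_le_mul_of_nonneg_left (pow_le_pow_left₀ hx hp n) hx
  have hsub : {A : Set (Fin d → ℤ) | (0 : Fin d → ℤ) ∈ uClosure U A} ⊆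
      ⋃ n, {A | ∃ B ⊆ A, ∃ z ∈ sparse (radius Q) (isolation Q) B n,
        z ∈ ballFinset 0 (Q ^ ((n + 1) ^ 2))} := by
    intro A hA
    obtain ⟨B, hB, n, z, hz⟩ := hnear A hA
    exact Set.mem_iUnion.2 ⟨n, B, hB, z, hz⟩
  have hsum : HasSum (fun n : ℕ => Λ * p * (1 / 2 : ℝ) ^ n) (Λ * p * 2) :=
    hasSum_geometric_two.mul_left _
  have hle : siteLaw d p {A | (0 : Fin d → ℤ) ∈ uClosure U A} ≤ ENNReal.ofReal (2 * Λ * p) := by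
    calc _ ≤ ∑' n : ℕ, ENNReal.ofReal (Λ * p * (1 / 2) ^ n) :=
          ((measure_mono hsub).trans (measure_iUnion_le _)).trans (ENNReal.tsum_le_tsum fun n =>
            (siteLaw_near_sparse_le hQ p n).trans (ENNReal.ofReal_le_ofReal (hterm n)))
      _ = ENNReal.ofReal (2 * Λ * p) := by
          rw [← ENNReal.ofReal_tsum_of_nonneg (fun n => by positivity) hsum.summable,
            hsum.tsum_eq]
          ring_nf
  exact ENNReal.toReal_le_of_le_ofReal (by positivity) hle

theorem criticalProb_pos_of_siteLaw_le {U : UpdateFamily d} {C : ℝ} (hC : 0 < C)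
    (h : ∀ p : unitInterval,
      (siteLaw d p).real {A | (0 : Fin d → ℤ) ∈ uClosure U A} ≤ C * p) :
    0 < criticalProb U := by
  refine lt_of_lt_of_le (by positivity : 0 < 1 / (2 * C)) (le_csInf ?_ ?_)
  -- Nonemptiness matters: `sInf ∅` would be `0`.
  · exact ⟨1, unitInterval.one_mem, half_le_siteLaw_one_univ U⟩
  · rintro p ⟨hp, hhalf⟩
    have h1 : (siteLaw d ⟨p, hp⟩).real {A | uClosure U A = Set.univ} ≤
        (siteLaw d ⟨p, hp⟩).real {A | (0 : Fin d → ℤ) ∈ uClosure U A} :=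
      measureReal_mono fun A hA => by
        change uClosure U A = Set.univ at hA
        change (0 : Fin d → ℤ) ∈ uClosure U A
        rw [hA]
        trivial
    have h2 := hhalf.trans (h1.trans (h ⟨p, hp⟩))
    change 1 / 2 ≤ C * p at h2
    rw [div_le_iff₀ (by positivity)]
    linarith

end Subcritical

end UBootstrap

theorem theorem2p1 (d : ℕ) (hd : 1 ≤ d) (U : UBootstrap.UpdateFamily d)
    (hU : UBootstrap.IsSubcritical U) :
    (∃ C : ℝ, 0 < C ∧ ∀ p : unitInterval,
      (UBootstrap.siteLaw d p).real {A | (0 : Fin d → ℤ) ∈ UBootstrap.uClosure U A} ≤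
        C * (p : ℝ) ^ (2 / 3 : ℝ)) ∧
    0 < UBootstrap.criticalProb U := by
  obtain ⟨C, hC, h⟩ := hU.exists_siteLaw_le hd
  refine ⟨⟨C, hC, fun p => (h p).trans (mul_le_mul_of_nonneg_left ?_ hC.le)⟩,
    UBootstrap.criticalProb_pos_of_siteLaw_le hC h⟩
  exact Real.self_le_rpow_of_le_one p.2.1 p.2.2 (by norm_num)
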